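/- \textbf{Junta theorem for decision lists.} A \emph{term} over the Boolean variables $x_1,\dots,x_n$ is a conjunction of literals in which no variable appears more than once. A \emph{decision list} on $\{0,1\}^n$ with values in a set $V$ is a finite nonempty list of rules $(C_1,v_1),\dots,(C_m,v_m)$, where each $C_i$ is a term, each $v_i\in V$, and $C_m\equiv 1$; it computes the function sending $x$ to $v_i$, where $i$ is the least index with $C_i(x)=1$. Its size is $m$, and it has width $w$ if every $C_i$ contains at most $w$ literals. A $k$-\emph{junta} is a function on $\{0,1\}^n$ that depends on at most $k$ of the variables. A function $g$ \emph{$\varepsilon$-approximates} $f$ if $f$ and $g$ agree on at least a $1-\varepsilon$ fraction of the points of $\{0,1\}^n$. There is an absolute constant $C\in\mathbb N$ such that for every integer $w\ge 1$, every real $\varepsilon>0$, every $n$ and every set $V$, each width-$w$ decision list on $\{0,1\}^n$ with values in $V$ can be $\varepsilon$-approximated by a $k$-junta $g:\{0,1\}^n\to V$ for some $$k\le\Bigl(2+\tfrac1w\log_2\tfrac1\varepsilon\Bigr)^{Cw}.$$ Moreover, every width-$w$ decision list of size $s$ computes an $(sw)$-junta. -/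

import Mathlib

namespace DecLists

/-- A literal on the variables `x_0, …, x_{n-1}`: the pair `(i, true)` is `x_i`,
the pair `(i, false)` is `¬ x_i`. -/
abbrev Literal (n : ℕ) : Type := Fin n × Bool

/-- A term: a conjunction of literals in which no variable appears more than once. -/
structure Term (n : ℕ) where
  literals : Finset (Literal n)
  no_repeat : ∀ l ∈ literals, ∀ l' ∈ literals, l.1 = l'.1 → l = l'

/-- The term is true on the input `x`. -/
def Term.Holds {n : ℕ} (T : Term n) (x : Fin n → Bool) : Prop :=
  ∀ l ∈ T.literals, x l.1 = l.2

instance Term.instDecidableHolds {n : ℕ} (T : Term n) (x : Fin n → Bool) :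
    Decidable (T.Holds x) :=
  inferInstanceAs (Decidable (∀ l ∈ T.literals, x l.1 = l.2))

/-- The number of literals (equivalently, of variables) in a term. -/
def Term.width {n : ℕ} (T : Term n) : ℕ := T.literals.card

/-- A decision list on `n` variables with values in `V`: a list of `m + 1` rules
`(term i, value i)`, the last of which is the default rule, whose term is identically true. -/
structure DecisionList (n : ℕ) (V : Type*) where
  m : ℕ
  term : Fin (m + 1) → Term n
  value : Fin (m + 1) → V
  term_last : ∀ x, (term (Fin.last m)).Holds x

namespace DecisionList

variable {n : ℕ} {V : Type*}

/-- The number of rules. -/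
def size (L : DecisionList n V) : ℕ := L.m + 1

/-- The maximal number of literals in a term. -/
def width (L : DecisionList n V) : ℕ := Finset.univ.sup fun i => (L.term i).width

/-- The index of the first rule whose term is true on `x`. -/
def index (L : DecisionList n V) (x : Fin n → Bool) : Fin (L.m + 1) :=
  (Finset.univ.filter fun i => (L.term i).Holds x).min'
    ⟨Fin.last L.m, Finset.mem_filter.mpr ⟨Finset.mem_univ _, L.term_last x⟩⟩

/-- The function computed by a decision list. -/
def eval (L : DecisionList n V) (x : Fin n → Bool) : V := L.value (L.index x)

end DecisionList

/-- A `k`-junta: a function on the Boolean cube that depends on at most `k` variables. -/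
def IsJunta {n : ℕ} {V : Type*} (k : ℕ) (f : (Fin n → Bool) → V) : Prop :=
  ∃ S : Finset (Fin n), S.card ≤ k ∧ DependsOn f (S : Set (Fin n))

open Classical in
/-- `g` is an `ε`-approximation of `f`: the two agree on at least a `1 - ε` fraction of the
`2 ^ n` inputs. -/
def Approximates {n : ℕ} {V : Type*} (ε : ℝ) (g f : (Fin n → Bool) → V) : Prop :=
  1 - ε ≤ ((Finset.univ.filter fun x => g x = f x).card : ℝ) / 2 ^ n

end DecLists

/-! Let `p i` be the probability that rule `i` fires first. The core is a bound free of the list's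
size: `∑ p i ^ l ≤ (2 / l) ^ w` (`sum_cellProb_rpow_le`). Take a random restriction freeing each
coordinate with probability `2 * b - 1`, where `b = 2 ^ (-l)`. A set of density `p` is hit with
probability at least `p ^ l` (`density_rpow_le_hitProb`). Conversely, a restriction hitting cell `i`
can be filled on the variables of term `i` so that `i` becomes its first forced rule. Filling costs
a factor `b / (1 - b)` per variable, and first-forced events are disjoint (`sum_hitProb_cell_le`).
Discarding the rules with `p i < τ` then loses little mass and leaves few rules; `l` and `τ` are
tuned in `threshold_bounds`. Keeping every rule gives the second claim. -/

namespace DecLists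

open Finset

/-! ### Two-point inequalities for powers. -/

section RealInequalities

/-- Majorization for the concave function `x ↦ x ^ l`. -/
lemma rpow_add_rpow_le_of_le {u v l : ℝ} (hu : 0 ≤ u) (huv : u ≤ v) (hl₀ : 0 ≤ l) (hl₁ : l ≤ 1) :
    u ^ l + (u + v) ^ l ≤ (2 * u) ^ l + v ^ l := by
  rcases hu.eq_or_lt with rfl | hu'
  · simp
  have hv : 0 < v := hu'.trans_le huv
  have hs₀ : 0 ≤ u / v := by positivity
  have hs₁ : 0 ≤ 1 - u / v := by
    rw [sub_nonneg, div_le_one hv]; exact huv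
  have hc := Real.concaveOn_rpow hl₀ hl₁
  -- `2 * u` and `v` are mixtures of `u` and `u + v` with swapped weights, so the weights cancel in
  -- the sum.
  have h₁ := hc.2 (x := u) (y := u + v) hu (by simp only [Set.mem_Ici]; positivity) hs₁ hs₀
    (by ring)
  have h₂ := hc.2 (x := u) (y := u + v) hu (by simp only [Set.mem_Ici]; positivity) hs₀ hs₁
    (by ring)
  simp only [smul_eq_mul] at h₁ h₂
  rw [show (1 - u / v) * u + u / v * (u + v) = 2 * u by field_simp; ring] at h₁
  rw [show u / v * u + (1 - u / v) * (u + v) = v by field_simp; ring] at h₂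
  linarith

/-- Equality at `u = 0` and at `u = v` dictates the weight `2 ^ (-l)`. This is the induction step
for the hitting bound. -/
lemma midpoint_rpow_le {u v l : ℝ} (hu : 0 ≤ u) (huv : u ≤ v) (hl₀ : 0 ≤ l) (hl₁ : l ≤ 1) :
    ((u + v) / 2) ^ l ≤ (1 - 2 ^ (-l)) * u ^ l + 2 ^ (-l) * v ^ l := by
  have hv : 0 ≤ v := hu.trans huv
  have h := rpow_add_rpow_le_of_le hu huv hl₀ hl₁
  rw [Real.mul_rpow zero_le_two hu] at h
  have h2 : (2 : ℝ) ^ (-l) * 2 ^ l = 1 := by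
    rw [← Real.rpow_add two_pos]; simp
  have hb : (0 : ℝ) < 2 ^ (-l) := by positivity
  rw [div_eq_mul_inv, Real.mul_rpow (by positivity) (by positivity), Real.inv_rpow zero_le_two,
    ← Real.rpow_neg zero_le_two]
  have := mul_le_mul_of_nonneg_left h hb.le
  rw [mul_add, mul_add, ← mul_assoc, h2] at this
  linarith

lemma two_rpow_neg_le {l : ℝ} (hl₀ : 0 ≤ l) (hl₁ : l ≤ 1) : (2 : ℝ) ^ (-l) ≤ 1 - l / 2 := by
  have h := rpow_one_add_le_one_add_mul_self (s := -(1 / 2)) (by norm_num) hl₀ hl₁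
  rw [Real.rpow_neg zero_le_two, ← Real.inv_rpow zero_le_two]
  norm_num at h ⊢
  linarith

end RealInequalities

lemma sum_biUnion_le_sum_sum {α β : Type*} [DecidableEq β] {f : β → ℝ} (hf : ∀ x, 0 ≤ f x)
    (s : Finset α) (t : α → Finset β) :
    ∑ x ∈ s.biUnion t, f x ≤ ∑ a ∈ s, ∑ x ∈ t a, f x := by
  classical
  induction s using Finset.induction_on with
  | empty => simp
  | insert a s ha ih =>
    rw [biUnion_insert, sum_insert ha]
    have := sum_union_inter (s₁ := t a) (s₂ := s.biUnion t) (f := f)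
    have := sum_nonneg fun x (_ : x ∈ t a ∩ s.biUnion t) => hf x
    linarith

/-! ### Random restrictions and hitting probabilities. -/

section Restrictions

variable {n : ℕ}

/-- The weight of a single coordinate of a random restriction: a coordinate is left free with
probability `2 * b - 1`, and set to either bit with probability `1 - b`. -/
def coordWeight (b : ℝ) : Option Bool → ℝ
  | none => 2 * b - 1
  | some _ => 1 - b

/-- The probability of the restriction `r`. -/
def restrictionWeight (b : ℝ) (r : Fin n → Option Bool) : ℝ := ∏ j, coordWeight b (r j)

/-- The point `x` lies in the subcube of the restriction `r`. -/
def Extends (x : Fin n → Bool) (r : Fin n → Option Bool) : Prop :=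
  ∀ j, r j = none ∨ r j = some (x j)

/-- The restriction `r` has an extension in `A`. -/
def Hits (A : Finset (Fin n → Bool)) (r : Fin n → Option Bool) : Prop := ∃ x ∈ A, Extends x r

open Classical in
/-- The probability that the subcube of a random restriction meets `A`. -/
noncomputable def hitProb (b : ℝ) (A : Finset (Fin n → Bool)) : ℝ :=
  ∑ r, if Hits A r then restrictionWeight b r else 0

lemma coordWeight_nonneg {b : ℝ} (hb₀ : 1 / 2 ≤ b) (hb₁ : b ≤ 1) (o : Option Bool) :
    0 ≤ coordWeight b o := by
  cases o <;> simp only [coordWeight] <;> linarith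

lemma restrictionWeight_nonneg {b : ℝ} (hb₀ : 1 / 2 ≤ b) (hb₁ : b ≤ 1)
    (r : Fin n → Option Bool) : 0 ≤ restrictionWeight b r :=
  prod_nonneg fun _ _ => coordWeight_nonneg hb₀ hb₁ _

lemma sum_restrictionWeight (b : ℝ) : ∑ r : Fin n → Option Bool, restrictionWeight b r = 1 := by
  simp only [restrictionWeight]
  rw [← Fintype.prod_sum (fun (_ : Fin n) o => coordWeight b o)]
  refine prod_eq_one fun _ _ => ?_
  simp only [Fintype.sum_option, Fintype.sum_bool, coordWeight]
  ring

/-- The section of `A` on which the first coordinate is `v`. -/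
def headSection (A : Finset (Fin (n + 1) → Bool)) (v : Bool) : Finset (Fin n → Bool) :=
  univ.filter fun y => (Fin.cons v y : Fin (n + 1) → Bool) ∈ A

lemma card_headSection_add (A : Finset (Fin (n + 1) → Bool)) :
    (headSection A false).card + (headSection A true).card = A.card := by
  have key : ∀ v, (headSection A v).card = (A.filter fun x => x 0 = v).card := by
    intro v
    refine card_bij' (fun y _ => (Fin.cons v y : Fin (n + 1) → Bool)) (fun x _ => Fin.tail x)
      ?_ ?_ ?_ ?_
    · intro y hy
      simpa [headSection] using hy
    · intro x hx
      obtain ⟨hx, rfl⟩ := mem_filter.1 hx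
      simpa [headSection, Fin.cons_self_tail] using hx
    · intro y _
      simp
    · intro x hx
      obtain ⟨_, rfl⟩ := mem_filter.1 hx
      exact Fin.cons_self_tail x
  rw [key, key, add_comm, ← card_filter_add_card_filter_not (s := A) (fun x => x 0 = true)]
  simp

lemma hits_cons_some (A : Finset (Fin (n + 1) → Bool)) (v : Bool) (r : Fin n → Option Bool) :
    Hits A (Fin.cons (some v) r) ↔ Hits (headSection A v) r := by
  constructor
  · rintro ⟨x, hx, hr⟩
    have h0 : v = x 0 := by simpa using hr 0
    refine ⟨Fin.tail x, ?_, fun j => by simpa [Fin.tail] using hr j.succ⟩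
    simpa [headSection, h0, Fin.cons_self_tail] using hx
  · rintro ⟨y, hy, hr⟩
    refine ⟨Fin.cons v y, by simpa [headSection] using hy, fun j => ?_⟩
    cases j using Fin.cases with
    | zero => simp
    | succ j => simpa using hr j

lemma Hits.cons_none {A : Finset (Fin (n + 1) → Bool)} {v : Bool} {r : Fin n → Option Bool}
    (h : Hits (headSection A v) r) : Hits A (Fin.cons none r) := by
  obtain ⟨y, hy, hr⟩ := h
  refine ⟨Fin.cons v y, by simpa [headSection] using hy, fun j => ?_⟩
  cases j using Fin.cases with
  | zero => simp
  | succ j => simpa using hr j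

/-- When the first coordinate is free, hitting section `v` suffices; this adds `2 * b - 1` to the `1
- b` from fixing it to `v`. -/
lemma hitProb_succ_ge {b : ℝ} (hb₀ : 1 / 2 ≤ b) (hb₁ : b ≤ 1)
    (A : Finset (Fin (n + 1) → Bool)) (v : Bool) :
    (1 - b) * hitProb b (headSection A (!v)) + b * hitProb b (headSection A v) ≤ hitProb b A := by
  classical
  have hsum : hitProb b A = ∑ o : Option Bool, ∑ r : Fin n → Option Bool,
      if Hits A (Fin.cons o r) then coordWeight b o * restrictionWeight b r else 0 := by
    rw [hitProb, ← Fintype.sum_prod_type', ← (Fin.consEquiv fun _ => Option Bool).sum_comp]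
    refine Fintype.sum_congr _ _ fun p => ?_
    simp [Fin.consEquiv, restrictionWeight, Fin.prod_univ_succ]
  have hsome : ∀ u, (∑ r : Fin n → Option Bool, if Hits A (Fin.cons (some u) r) then
      coordWeight b (some u) * restrictionWeight b r else 0)
        = (1 - b) * hitProb b (headSection A u) := by
    intro u
    simp only [hits_cons_some, hitProb, mul_sum, coordWeight, mul_ite, mul_zero]
  have hnone : (2 * b - 1) * hitProb b (headSection A v) ≤
      ∑ r : Fin n → Option Bool, if Hits A (Fin.cons none r) then
        coordWeight b none * restrictionWeight b r else 0 := by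
    rw [hitProb, mul_sum]
    refine sum_le_sum fun r _ => ?_
    have hw : 0 ≤ (2 * b - 1) * restrictionWeight b r :=
      mul_nonneg (by linarith) (restrictionWeight_nonneg hb₀ hb₁ r)
    by_cases h : Hits (headSection A v) r
    · simp [h, h.cons_none, coordWeight]
    · simp only [h, if_false, mul_zero, coordWeight]
      split_ifs <;> simp [hw]
  rw [hsum, Fintype.sum_option, Fintype.sum_bool, hsome, hsome]
  cases v <;> simp only [Bool.not_true, Bool.not_false] <;> linarith

/-- A set of density `p` is hit by a random restriction with probability at least `p ^ l`. -/
lemma density_rpow_le_hitProb {l : ℝ} (hl₀ : 0 < l) (hl₁ : l ≤ 1) :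
    ∀ {n : ℕ} (A : Finset (Fin n → Bool)),
      ((A.card : ℝ) / 2 ^ n) ^ l ≤ hitProb (2 ^ (-l)) A := by
  have hb₁ : (2 : ℝ) ^ (-l) ≤ 1 := Real.rpow_le_one_of_one_le_of_nonpos one_le_two (by linarith)
  have hb₀ : (1 : ℝ) / 2 ≤ 2 ^ (-l) := by
    rw [one_div, ← Real.rpow_neg_one]
    exact Real.rpow_le_rpow_of_exponent_le one_le_two (by linarith)
  intro n
  induction n with
  | zero =>
    intro A
    rcases A.eq_empty_or_nonempty with rfl | ⟨x, hx⟩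
    · simp [hitProb, Hits, Real.zero_rpow hl₀.ne']
    · have hA : A = {x} := by
        ext y; simp [Subsingleton.elim y x, hx]
      simp [hitProb, Hits, hA, Extends, restrictionWeight]
  | succ n ih =>
    intro A
    -- The larger section gets the larger weight `b`, as the midpoint inequality requires.
    have key : ∀ v, (headSection A (!v)).card ≤ (headSection A v).card →
        ((A.card : ℝ) / 2 ^ (n + 1)) ^ l ≤ hitProb (2 ^ (-l)) A := by
      intro v hv
      refine le_trans ?_ (hitProb_succ_ge hb₀ hb₁ A v)
      have hcard : (A.card : ℝ) = (headSection A (!v)).card + (headSection A v).card := by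
        rw [← card_headSection_add A]
        cases v <;> push_cast <;> simp [add_comm]
      have h := midpoint_rpow_le (u := (headSection A (!v)).card / (2 : ℝ) ^ n)
        (v := (headSection A v).card / (2 : ℝ) ^ n) (l := l) (by positivity) (by gcongr) hl₀.le hl₁
      rw [hcard, pow_succ, ← div_div, add_div]
      refine h.trans (add_le_add ?_ ?_)
      · exact mul_le_mul_of_nonneg_left (ih _) (by linarith)
      · exact mul_le_mul_of_nonneg_left (ih _) (by linarith)
    rcases le_total (headSection A false).card (headSection A true).card with h | h
    · exact key true h
    · exact key false h

end Restrictions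

/-! ### Variables of terms and forced terms. -/

namespace Term

variable {n : ℕ}

/-- The variables that occur in a term. -/
def vars (T : Term n) : Finset (Fin n) := T.literals.image Prod.fst

lemma card_vars_le (T : Term n) : T.vars.card ≤ T.width := card_image_le

lemma holds_congr {T : Term n} {x y : Fin n → Bool} (h : ∀ j ∈ T.vars, x j = y j) :
    T.Holds x ↔ T.Holds y := by
  refine forall₂_congr fun l hl => ?_
  rw [h l.1 (mem_image_of_mem _ hl)]

lemma vars_eq_empty_of_forall_holds {T : Term n} (h : ∀ x, T.Holds x) : T.vars = ∅ := by
  rw [vars, image_eq_empty, eq_empty_iff_forall_notMem]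
  intro l hl
  have := h (fun _ => !l.2) l hl
  simp at this

/-- The term is true on the whole subcube of the restriction `r`. -/
def Forced (T : Term n) (r : Fin n → Option Bool) : Prop := ∀ l ∈ T.literals, r l.1 = some l.2

lemma Forced.holds {T : Term n} {r : Fin n → Option Bool} (h : T.Forced r) {x : Fin n → Bool}
    (hx : Extends x r) : T.Holds x := by
  intro l hl
  have := hx l.1
  rw [h l hl] at this
  simpa [eq_comm] using this

end Term

/-! ### Cells of a decision list and their hitting probabilities. -/

namespace DecisionList

variable {n : ℕ} {V : Type*} (L : DecisionList n V)

lemma holds_index (x : Fin n → Bool) : (L.term (L.index x)).Holds x :=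
  (mem_filter.1 (min'_mem _ _ : L.index x ∈ univ.filter fun i => (L.term i).Holds x)).2

lemma index_le {x : Fin n → Bool} {i : Fin (L.m + 1)} (h : (L.term i).Holds x) : L.index x ≤ i :=
  Finset.min'_le (univ.filter fun i => (L.term i).Holds x) i (mem_filter.2 ⟨mem_univ _, h⟩)

lemma width_term_le (i : Fin (L.m + 1)) : (L.term i).width ≤ L.width :=
  le_sup (f := fun i => (L.term i).width) (mem_univ i)

/-- The inputs on which rule `i` is the first one that applies. -/
def cell (i : Fin (L.m + 1)) : Finset (Fin n → Bool) := univ.filter fun x => L.index x = i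

/-- Rule `i` is the first one whose term is forced by the restriction `r`. -/
def FirstForced (i : Fin (L.m + 1)) (r : Fin n → Option Bool) : Prop :=
  (L.term i).Forced r ∧ ∀ j, (L.term j).Forced r → i ≤ j

/-- The restriction `r` with the variables of term `i` fixed according to an input `x`. -/
def fill (i : Fin (L.m + 1)) (x : Fin n → Bool) (r : Fin n → Option Bool) : Fin n → Option Bool :=
  fun j => if j ∈ (L.term i).vars then some (x j) else r j

/-- The point `x` still extends the filled restriction, so every term forced there holds at `x` and
cannot precede `i`. -/
lemma firstForced_fill {i : Fin (L.m + 1)} {x : Fin n → Bool} (hx : L.index x = i)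
    {r : Fin n → Option Bool} (hr : Extends x r) : L.FirstForced i (L.fill i x r) := by
  subst hx
  have hext : Extends x (L.fill (L.index x) x r) := by
    intro j
    by_cases hj : j ∈ (L.term (L.index x)).vars
    · simp [fill, hj]
    · simpa [fill, hj] using hr j
  refine ⟨fun l hl => ?_, fun j hj => L.index_le (hj.holds hext)⟩
  have hmem : l.1 ∈ (L.term (L.index x)).vars := mem_image_of_mem _ hl
  simp only [fill, hmem, if_true, L.holds_index x l hl]

/-- The restrictions obtained from `r` by freeing variables of term `i`. -/
def relaxations (i : Fin (L.m + 1)) (r : Fin n → Option Bool) : Finset (Fin n → Option Bool) :=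
  Fintype.piFinset fun j => if j ∈ (L.term i).vars then {none, r j} else {r j}

lemma sum_relaxations_le {b : ℝ} (hb₀ : 1 / 2 ≤ b) (hb₁ : b < 1) {i : Fin (L.m + 1)}
    {r : Fin n → Option Bool} (hr : (L.term i).Forced r) :
    ∑ r' ∈ L.relaxations i r, restrictionWeight b r'
      ≤ (b / (1 - b)) ^ L.width * restrictionWeight b r := by
  have hc : 0 < 1 - b := by linarith
  have hM : 1 ≤ b / (1 - b) := by rw [one_le_div hc]; linarith
  simp only [relaxations, restrictionWeight]
  rw [← Finset.prod_univ_sum (fun j => if j ∈ (L.term i).vars then {none, r j} else {r j})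
    (fun _ o => coordWeight b o)]
  -- At a variable of the term, the free and fixed weights add up to `(2 * b - 1) + (1 - b) = b`.
  have hfactor : ∀ j, (∑ o ∈ (if j ∈ (L.term i).vars then {none, r j} else {r j}),
      coordWeight b o) = (if j ∈ (L.term i).vars then b / (1 - b) else 1) * coordWeight b (r j) := by
    intro j
    split_ifs with hj
    · obtain ⟨l, hl, rfl⟩ := mem_image.1 hj
      rw [hr l hl, sum_pair (by simp)]
      simp only [coordWeight]
      field_simp
      ring
    · simp
  rw [prod_congr rfl fun j _ => hfactor j, prod_mul_distrib]
  refine mul_le_mul_of_nonneg_right ?_ (restrictionWeight_nonneg hb₀ hb₁.le r)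
  rw [prod_ite_mem, univ_inter, prod_const]
  exact pow_le_pow_right₀ hM ((L.term i).card_vars_le.trans (L.width_term_le i))

-- A restriction hitting the cell is a relaxation of its filling, so a union bound over fillings
-- applies.
open Classical in
lemma hitProb_cell_le {b : ℝ} (hb₀ : 1 / 2 ≤ b) (hb₁ : b < 1) (i : Fin (L.m + 1)) :
    hitProb b (L.cell i) ≤ (b / (1 - b)) ^ L.width *
      ∑ r, if L.FirstForced i r then restrictionWeight b r else 0 := by
  have hnn := restrictionWeight_nonneg (n := n) hb₀ hb₁.le
  rw [hitProb, ← sum_filter, ← sum_filter, mul_sum]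
  calc ∑ r ∈ univ.filter (fun r => Hits (L.cell i) r), restrictionWeight b r
      ≤ ∑ r ∈ (univ.filter fun r => L.FirstForced i r).biUnion (L.relaxations i),
          restrictionWeight b r := by
        refine sum_le_sum_of_subset_of_nonneg (fun r hr => ?_) fun r _ _ => hnn r
        obtain ⟨x, hx, hxr⟩ := (mem_filter.1 hr).2
        have hxi : L.index x = i := (mem_filter.1 hx).2
        refine mem_biUnion.2 ⟨L.fill i x r,
          mem_filter.2 ⟨mem_univ _, L.firstForced_fill hxi hxr⟩, ?_⟩
        refine Fintype.mem_piFinset.2 fun j => ?_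
        by_cases hj : j ∈ (L.term i).vars
        · simpa [fill, hj] using hxr j
        · simp [fill, hj]
    _ ≤ ∑ r ∈ univ.filter (fun r => L.FirstForced i r), ∑ r' ∈ L.relaxations i r,
          restrictionWeight b r' := sum_biUnion_le_sum_sum hnn _ _
    _ ≤ _ := sum_le_sum fun r hr => L.sum_relaxations_le hb₀ hb₁ (mem_filter.1 hr).2.1

lemma sum_hitProb_cell_le {b : ℝ} (hb₀ : 1 / 2 ≤ b) (hb₁ : b < 1) :
    ∑ i, hitProb b (L.cell i) ≤ (b / (1 - b)) ^ L.width := by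
  classical
  have hc : 0 < 1 - b := by linarith
  refine (sum_le_sum fun i _ => L.hitProb_cell_le hb₀ hb₁ i).trans ?_
  rw [← mul_sum, sum_comm]
  refine mul_le_of_le_one_right (pow_nonneg (div_nonneg (by linarith) hc.le) _) ?_
  rw [← sum_restrictionWeight (n := n) b]
  refine sum_le_sum fun r _ => ?_
  rw [← sum_filter, sum_const, nsmul_eq_mul]
  refine mul_le_of_le_one_left (restrictionWeight_nonneg hb₀ hb₁.le r) ?_
  -- A restriction has at most one first forced rule.
  rw [Nat.cast_le_one, card_le_one]
  intro i hi j hj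
  have hi := (mem_filter.1 hi).2
  have hj := (mem_filter.1 hj).2
  exact le_antisymm (hi.2 j hj.1) (hj.2 i hi.1)

/-- The probability that rule `i` is the first one that applies to a uniform input. -/
noncomputable def cellProb (i : Fin (L.m + 1)) : ℝ := ((L.cell i).card : ℝ) / 2 ^ n

lemma cellProb_nonneg (i : Fin (L.m + 1)) : 0 ≤ L.cellProb i := by
  unfold cellProb; positivity

lemma sum_cellProb_rpow_le {l : ℝ} (hl₀ : 0 < l) (hl₁ : l ≤ 1) :
    ∑ i, L.cellProb i ^ l ≤ (2 / l) ^ L.width := by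
  have hb := two_rpow_neg_le hl₀.le hl₁
  have hb₀ : (1 : ℝ) / 2 ≤ 2 ^ (-l) := by
    rw [one_div, ← Real.rpow_neg_one]
    exact Real.rpow_le_rpow_of_exponent_le one_le_two (by linarith)
  have hc : l / 2 ≤ 1 - 2 ^ (-l) := by linarith
  have hc' : 0 < l / 2 := by linarith
  refine (sum_le_sum fun i _ => density_rpow_le_hitProb hl₀ hl₁ (L.cell i)).trans ?_
  refine (L.sum_hitProb_cell_le hb₀ (by linarith)).trans ?_
  refine pow_le_pow_left₀ (div_nonneg (by linarith) (by linarith)) ?_ _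
  calc (2 : ℝ) ^ (-l) / (1 - 2 ^ (-l)) ≤ 1 / (l / 2) := by
        gcongr
        linarith
    _ = 2 / l := by field_simp

/-! ### Truncating the list to its heavy rules. -/

open Classical in
/-- The value of the decision list formed by the rules in `K` and the default rule. -/
noncomputable def evalOn (K : Finset (Fin (L.m + 1))) (x : Fin n → Bool) : V :=
  L.value <| ((insert (Fin.last L.m) K).filter fun i => (L.term i).Holds x).min'
    ⟨Fin.last L.m, mem_filter.2 ⟨mem_insert_self _ _, L.term_last x⟩⟩

lemma evalOn_eq_eval {K : Finset (Fin (L.m + 1))} {x : Fin n → Bool} (h : L.index x ∈ K) :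
    L.evalOn K x = L.eval x := by
  classical
  rw [evalOn, eval]
  congr 1
  refine le_antisymm (min'_le _ _ ?_) (le_min' _ _ _ fun i hi => L.index_le (mem_filter.1 hi).2)
  exact mem_filter.2 ⟨mem_insert_of_mem h, L.holds_index x⟩

lemma isJunta_evalOn (K : Finset (Fin (L.m + 1))) {w : ℕ} (hw : L.width ≤ w) :
    IsJunta (K.card * w) (L.evalOn K) := by
  classical
  refine ⟨K.biUnion fun i => (L.term i).vars, ?_, ?_⟩
  · exact card_biUnion_le_card_mul _ _ _ fun i _ =>
      (L.term i).card_vars_le.trans ((L.width_term_le i).trans hw)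
  · intro x y hxy
    rw [evalOn, evalOn]
    congr 2
    refine filter_congr fun i hi => ?_
    refine Term.holds_congr fun j hj => ?_
    -- The default rule has no variables, so keeping it is free.
    rcases mem_insert.1 hi with rfl | hi
    · rw [Term.vars_eq_empty_of_forall_holds L.term_last] at hj
      simp at hj
    · exact hxy j (by simpa using ⟨i, hi, hj⟩)

lemma approximates_evalOn {K : Finset (Fin (L.m + 1))} {ε : ℝ}
    (h : ∑ i ∈ univ.filter (· ∉ K), L.cellProb i ≤ ε) : Approximates ε (L.evalOn K) L.eval := by
  classical
  have hsum : (∑ i ∈ univ.filter (· ∉ K), L.cellProb i)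
      = ((univ.filter fun x => L.index x ∉ K).card : ℝ) / 2 ^ n := by
    rw [card_eq_sum_card_fiberwise (f := L.index) (t := univ.filter (· ∉ K))
      (fun x hx => by simpa using hx), Nat.cast_sum, sum_div]
    refine sum_congr rfl fun i hi => ?_
    rw [cellProb, cell, filter_filter]
    congr 3
    refine filter_congr fun x _ => ?_
    constructor
    · rintro rfl
      exact ⟨(mem_filter.1 hi).2, rfl⟩
    · exact fun h => h.2
  have hcard := card_filter_add_card_filter_not (s := (univ : Finset (Fin n → Bool)))
    (fun x => L.index x ∈ K)
  have hle : (univ.filter fun x => L.index x ∈ K).card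
      ≤ (univ.filter fun x => L.evalOn K x = L.eval x).card :=
    card_le_card fun x hx =>
      mem_filter.2 ⟨mem_univ _, L.evalOn_eq_eval (mem_filter.1 hx).2⟩
  have hone : (((univ.filter fun x => L.index x ∈ K).card : ℝ)
      + (univ.filter fun x => L.index x ∉ K).card) / 2 ^ n = 1 := by
    rw [← Nat.cast_add, hcard]
    simp
  rw [add_div, ← hsum] at hone
  have : ((univ.filter fun x => L.index x ∈ K).card : ℝ) / 2 ^ n
      ≤ ((univ.filter fun x => L.evalOn K x = L.eval x).card : ℝ) / 2 ^ n := by gcongr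
  unfold Approximates
  convert (by linarith : 1 - ε ≤ _) using 1

/-- Keeping the rules that are used with probability at least `τ`, where
`∑ i, L.cellProb i ^ l ≤ M`. -/
lemma exists_heavy_rules {l M τ : ℝ} (hl₁ : l ≤ 1) (hτ : 0 < τ) (hl₀ : 0 ≤ l)
    (hM : ∑ i, L.cellProb i ^ l ≤ M) :
    ∃ K : Finset (Fin (L.m + 1)), (K.card : ℝ) ≤ M / τ ^ l ∧
      ∑ i ∈ univ.filter (· ∉ K), L.cellProb i ≤ τ ^ (1 - l) * M := by
  classical
  have hp := L.cellProb_nonneg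
  refine ⟨univ.filter fun i => τ ≤ L.cellProb i, ?_, ?_⟩
  · rw [le_div_iff₀ (by positivity), ← nsmul_eq_mul]
    refine (card_nsmul_le_sum _ (fun i => L.cellProb i ^ l) _ fun i hi =>
      Real.rpow_le_rpow hτ.le (mem_filter.1 hi).2 hl₀).trans (le_trans ?_ hM)
    exact sum_le_sum_of_subset_of_nonneg (filter_subset _ _)
      fun i _ _ => Real.rpow_nonneg (hp i) _
  · refine le_trans ?_ (mul_le_mul_of_nonneg_left hM (by positivity))
    rw [mul_sum]
    refine (sum_le_sum fun i hi => ?_).trans (sum_le_sum_of_subset_of_nonneg (filter_subset _ _)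
      fun i _ _ => mul_nonneg (by positivity) (Real.rpow_nonneg (hp i) _))
    have hi : L.cellProb i < τ := by simpa using hi
    calc L.cellProb i = L.cellProb i ^ (1 - l) * L.cellProb i ^ l := by
          rw [← Real.rpow_add' (hp i) (by norm_num)]; simp
      _ ≤ τ ^ (1 - l) * L.cellProb i ^ l :=
          mul_le_mul_of_nonneg_right (Real.rpow_le_rpow (hp i) hi.le (by linarith))
            (Real.rpow_nonneg (hp i) _)

end DecisionList

/-! ### Choice of parameters and conclusion. -/

/-- With `t = 2 + log₂ (1 / ε) / w`, `l = 1 / t` and `M = (2 t) ^ w`, the threshold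
`τ = (ε / M) ^ 2` makes the loss at most `ε` and keeps at most `t ^ (6 w)` rules. -/
lemma threshold_bounds {w : ℕ} {ε t : ℝ} (ht : 2 ≤ t) (hε : ε = 2 ^ (-((w : ℝ) * (t - 2)))) :
    ((ε / (2 * t) ^ w) ^ 2) ^ (1 - 1 / t) * (2 * t) ^ w ≤ ε ∧
      (2 * t) ^ w / ((ε / (2 * t) ^ w) ^ 2) ^ (1 / t) ≤ t ^ (6 * w) := by
  have ht₀ : 0 < t := by linarith
  have hε₀ : 0 < ε := by rw [hε]; positivity
  have hε₁ : ε ≤ 1 := by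
    rw [hε]
    refine Real.rpow_le_one_of_one_le_of_nonpos one_le_two ?_
    have : 0 ≤ (w : ℝ) * (t - 2) := mul_nonneg (by positivity) (by linarith)
    linarith
  have hM : 1 ≤ (2 * t) ^ w := one_le_pow₀ (by linarith)
  set M := (2 * t) ^ w with hMdef
  have hM₀ : 0 < M := by linarith
  have hq₀ : 0 < ε / M := by positivity
  have hq₁ : ε / M ≤ 1 := by rw [div_le_one hM₀]; linarith
  have hinv : 1 / t ≤ 1 / 2 := by gcongr
  have hsq : ∀ y : ℝ, ((ε / M) ^ 2) ^ y = (ε / M) ^ (2 * y) := fun y => by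
    rw [← Real.rpow_natCast, ← Real.rpow_mul hq₀.le]; norm_num
  constructor
  · rw [hsq]
    -- Squaring in `τ` makes the exponent at least `1`, since `t ≥ 2`.
    have : (ε / M) ^ (2 * (1 - 1 / t)) ≤ ε / M := by
      conv_rhs => rw [← Real.rpow_one (ε / M)]
      exact Real.rpow_le_rpow_of_exponent_ge hq₀ hq₁ (by linarith)
    calc _ ≤ ε / M * M := mul_le_mul_of_nonneg_right this hM₀.le
      _ = ε := by field_simp
  · rw [hsq, Real.div_rpow hε₀.le hM₀.le, div_div_eq_mul_div]
    have h₁ : M ^ (2 * (1 / t)) ≤ M := by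
      conv_rhs => rw [← Real.rpow_one M]
      exact Real.rpow_le_rpow_of_exponent_le hM (by linarith)
    have h₂ : (4 ^ w : ℝ)⁻¹ ≤ ε ^ (2 * (1 / t)) := by
      have h4 : (4 ^ w : ℝ)⁻¹ = 2 ^ (-(2 * (w : ℝ))) := by
        rw [Real.rpow_neg zero_le_two, Real.rpow_mul zero_le_two]
        norm_num
      rw [h4, hε, ← Real.rpow_mul zero_le_two]
      refine Real.rpow_le_rpow_of_exponent_le one_le_two ?_
      have : -(↑w * (t - 2)) * (2 * (1 / t)) = -(2 * (w : ℝ)) + 4 * w / t := by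
        field_simp; ring
      rw [this]
      have : 0 ≤ 4 * (w : ℝ) / t := by positivity
      linarith
    calc M * M ^ (2 * (1 / t)) / ε ^ (2 * (1 / t)) ≤ M * M / (4 ^ w : ℝ)⁻¹ := by gcongr
      _ = (16 * t ^ 2) ^ w := by
          rw [div_inv_eq_mul, hMdef, ← mul_pow, ← mul_pow]
          congr 1
          ring
      _ ≤ (t ^ 4 * t ^ 2) ^ w := by
          have : (2 : ℝ) ^ 4 ≤ t ^ 4 := by gcongr
          gcongr
          linarith
      _ = t ^ (6 * w) := by rw [← pow_add, ← pow_mul]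

lemma DecisionList.exists_junta_approximation {n w : ℕ} {V : Type*} (L : DecisionList n V)
    (hw : 1 ≤ w) (hL : L.width ≤ w) {ε : ℝ} (hε : 0 < ε) :
    ∃ (k : ℕ) (g : (Fin n → Bool) → V), IsJunta k g ∧ Approximates ε g L.eval ∧
      (k : ℝ) ≤ (2 + 1 / (w : ℝ) * Real.logb 2 (1 / ε)) ^ (8 * w) := by
  have hw₀ : (0 : ℝ) < w := by exact_mod_cast hw
  rcases le_or_gt 1 ε with h1 | h1
  · refine ⟨0, fun _ => L.value (Fin.last L.m), ⟨∅, by simp, fun _ _ _ => rfl⟩, ?_, ?_⟩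
    · unfold Approximates
      refine le_trans (by linarith : 1 - ε ≤ 0) (by positivity)
    · rw [Nat.cast_zero]
      -- For large `ε` the base may be negative; an even exponent is needed, hence `8 * w` although
      -- `7 * w` suffices below.
      exact Even.pow_nonneg ⟨4 * w, by ring⟩ _
  set t := 2 + 1 / (w : ℝ) * Real.logb 2 (1 / ε) with ht
  have hlog : 0 ≤ Real.logb 2 (1 / ε) :=
    Real.logb_nonneg one_lt_two (by rw [one_le_div hε]; exact h1.le)
  have ht₂ : 2 ≤ t := by
    have : 0 ≤ 1 / (w : ℝ) * Real.logb 2 (1 / ε) := by positivity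
    linarith
  have hεt : ε = 2 ^ (-((w : ℝ) * (t - 2))) := by
    have : (w : ℝ) * (t - 2) = Real.logb 2 (1 / ε) := by rw [ht]; field_simp; ring
    rw [this, Real.rpow_neg zero_le_two, Real.rpow_logb two_pos (by norm_num) (by positivity)]
    simp
  obtain ⟨hb₁, hb₂⟩ := threshold_bounds (w := w) ht₂ hεt
  have hM : ∑ i, L.cellProb i ^ (1 / t) ≤ (2 * t) ^ w := by
    refine (L.sum_cellProb_rpow_le (by positivity)
      (by rw [div_le_one (by linarith)]; linarith)).trans ?_
    rw [show 2 / (1 / t) = 2 * t by field_simp]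
    exact pow_le_pow_right₀ (by linarith) hL
  obtain ⟨K, hK, hKε⟩ := L.exists_heavy_rules (τ := (ε / (2 * t) ^ w) ^ 2)
    (by rw [div_le_one (by linarith)]; linarith) (by positivity) (by positivity) hM
  refine ⟨K.card * w, L.evalOn K, L.isJunta_evalOn K hL, L.approximates_evalOn (hKε.trans hb₁), ?_⟩
  have hwt : (w : ℝ) ≤ t ^ w := by
    calc (w : ℝ) ≤ 2 ^ w := by exact_mod_cast Nat.lt_two_pow_self.le
      _ ≤ t ^ w := by gcongr
  calc ((K.card * w : ℕ) : ℝ) = K.card * w := by push_cast; rfl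
    _ ≤ t ^ (6 * w) * t ^ w := mul_le_mul (hK.trans hb₂) hwt hw₀.le (by positivity)
    _ = t ^ (7 * w) := by rw [← pow_add]; congr 1; ring
    _ ≤ t ^ (8 * w) := pow_le_pow_right₀ (by linarith) (by omega)

lemma DecisionList.isJunta_eval {n w : ℕ} {V : Type*} (L : DecisionList n V) (hL : L.width ≤ w) :
    IsJunta (L.size * w) L.eval := by
  have h := L.isJunta_evalOn univ hL
  have heval : L.evalOn univ = L.eval := funext fun x => L.evalOn_eq_eval (mem_univ _)
  rwa [card_univ, Fintype.card_fin, heval] at h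

end DecLists

theorem mainTheorem5 :
    (∃ C : ℕ, ∀ (w : ℕ) (ε : ℝ), 1 ≤ w → 0 < ε →
      ∀ (n : ℕ) (V : Type*) (L : DecLists.DecisionList n V), L.width ≤ w →
        ∃ (k : ℕ) (g : (Fin n → Bool) → V),
          DecLists.IsJunta k g ∧ DecLists.Approximates ε g L.eval ∧
          (k : ℝ) ≤ (2 + 1 / (w : ℝ) * Real.logb 2 (1 / ε)) ^ (C * w)) ∧
    (∀ (w s n : ℕ) (V : Type*) (L : DecLists.DecisionList n V),
      L.width ≤ w → L.size = s → DecLists.IsJunta (s * w) L.eval) :=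
  ⟨⟨8, fun _ _ hw hε _ _ L hL => L.exists_junta_approximation hw hL hε⟩,
    fun _ _ _ _ L hL hs => hs ▸ L.isJunta_eval hL⟩
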